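/- Let $m\ge 0$, let $\Omega\subset\mathbb{R}^m$ be open and convex, and for $K\subset\mathbb{R}^m$ put $T_K=\{x+iy : x\in\mathbb{R}^m,\ y\in K\}\subset\mathbb{C}^m$. Let $X$ be a compact (Hausdorff) complex manifold, equipped with any metric inducing its topology (since $X$ is compact, the notions below do not depend on the choice). A map $F$ defined on $T_K$ with values in $X$ is called semi periodic on $T_K$ if it is continuous on $T_K$ and the family of shifts $\{z\mapsto F(z+t)\}_{t\in\mathbb{R}^m}$ is relatively compact in the topology of uniform convergence on $T_K$. A holomorphic map $F:T_\Omega\to X$ is called semi periodic on $T_\Omega$ if its restriction to $T_K$ is semi periodic for every compact $K\subset\Omega$. Let $F:T_\Omega\to X$ be a holomorphic map that is uniformly continuous on $T_K$ for every compact $K\subset\Omega$. If for some $y'\in\Omega$ the restriction of $F$ to $\mathbb{R}^m+iy'=T_{\{y'\}}$ is semi periodic, then $F$ is semi periodic on $T_\Omega$. -/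

import Mathlib

open scoped Manifold ContDiff UniformConvergence

/-- The tube `T_K = {x + iy : x ∈ ℝ^m, y ∈ K}` in `ℂ^m` with base `K ⊆ ℝ^m`.
The tube with base `{y}` is the hyperplane `ℝ^m + iy`. -/
def tube {m : ℕ} (K : Set (Fin m → ℝ)) : Set (Fin m → ℂ) :=
  {z | (fun j => (z j).im) ∈ K}

/-- The inclusion of `ℝ^m` into `ℂ^m`. -/
def realVec {m : ℕ} (t : Fin m → ℝ) : Fin m → ℂ := fun j => (t j : ℂ)

/-- Real translations preserve tubes, so that the shifts of a map on `T_K` are maps on `T_K`. -/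
theorem add_realVec_mem_tube {m : ℕ} {K : Set (Fin m → ℝ)} {z : Fin m → ℂ} (hz : z ∈ tube K)
    (t : Fin m → ℝ) : z + realVec t ∈ tube K := by
  simpa [tube, realVec] using hz

/-- The shift `z ↦ F (z + t)`, `t ∈ ℝ^m`, as a map `T_K → X`, regarded as a point of the space
`tube K →ᵤ X` of all maps `T_K → X` with the topology of uniform convergence on `T_K`. -/
def shiftOnTube {m : ℕ} {X : Type*} (F : (Fin m → ℂ) → X) (K : Set (Fin m → ℝ))
    (t : Fin m → ℝ) : tube K →ᵤ X :=
  UniformFun.ofFun (fun z : tube K => F ((z : Fin m → ℂ) + realVec t))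

/-- `F` is semi periodic on the tube `T_K`: it is continuous there and the family of its shifts
along `ℝ^m` is relatively compact for the topology of uniform convergence on `T_K`.
(Uniform limits of continuous maps are continuous, so it makes no difference whether the closure
is taken among all maps or among the continuous ones.) -/
def SemiPeriodicOnTube {m : ℕ} {X : Type*} [MetricSpace X] (F : (Fin m → ℂ) → X)
    (K : Set (Fin m → ℝ)) : Prop :=
  ContinuousOn F (tube K) ∧ IsCompact (closure (Set.range (shiftOnTube F K)))

/-- A map on the tube `T_Ω` with open base `Ω` is semi periodic if its restriction to every tube
`T_K` with compact base `K ⊆ Ω` is. -/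
def SemiPeriodicOnOpenTube {m : ℕ} {X : Type*} [MetricSpace X] (F : (Fin m → ℂ) → X)
    (Ω : Set (Fin m → ℝ)) : Prop :=
  ∀ K : Set (Fin m → ℝ), IsCompact K → K ⊆ Ω → SemiPeriodicOnTube F K

/-! It suffices that translations whose shifts are uniformly close over `y'` have shifts uniformly
close over `K` (`exists_dist_shift_lt`): a finite net of shifts over `y'` then yields one over `K`.
Otherwise, after bad points are recentred to real part zero, there are two sequences of shifts whose
distance tends to zero over `y'` but not over some `y ∈ K`. Restrict them to the complex line with
imaginary direction from `y'` to `y` (`tendsto_dist_shift`). Compactness of `X` gives pointwise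
limits along an ultrafilter; uniform continuity of `F` makes the restrictions equicontinuous, so the
limits are holomorphic. They agree on the real axis, which lies over `y'`, hence by the identity
theorem also at `I`, which lies over `y`: a contradiction. -/

/-- Equicontinuity passes to pointwise limits. -/
theorem EquicontinuousAt.exists_ball_dist_le_of_tendsto {ι Y X : Type*} [PseudoMetricSpace Y]
    [PseudoMetricSpace X] {l : Filter ι} [l.NeBot] {g : ι → Y → X} {G : Y → X} {S : Set Y}
    (hS : IsOpen S) {y₀ : Y} (hy₀ : y₀ ∈ S) (heq : EquicontinuousAt g y₀)
    (hlim : ∀ y ∈ S, Filter.Tendsto (fun n => g n y) l (nhds (G y))) {ε : ℝ} (hε : 0 < ε) :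
    ∃ δ > 0, Metric.ball y₀ δ ⊆ S ∧
      ∀ y ∈ Metric.ball y₀ δ, (∀ n, dist (g n y) (g n y₀) ≤ ε) ∧ dist (G y) (G y₀) ≤ ε := by
  obtain ⟨δ₁, hδ₁, h₁⟩ := Metric.isOpen_iff.1 hS y₀ hy₀
  obtain ⟨δ₂, hδ₂, h₂⟩ := Metric.equicontinuousAt_iff.1 heq ε hε
  have key : ∀ y ∈ Metric.ball y₀ (min δ₁ δ₂), ∀ n, dist (g n y) (g n y₀) ≤ ε := by
    intro y hy n
    rw [dist_comm]
    exact (h₂ y (lt_of_lt_of_le hy (min_le_right _ _)) n).le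
  have hsub : Metric.ball y₀ (min δ₁ δ₂) ⊆ S :=
    (Metric.ball_subset_ball (min_le_left _ _)).trans h₁
  refine ⟨min δ₁ δ₂, lt_min hδ₁ hδ₂, hsub, fun y hy => ⟨key y hy, ?_⟩⟩
  exact le_of_tendsto ((hlim y (hsub hy)).dist (hlim y₀ hy₀)) (Filter.Eventually.of_forall (key y hy))

/-! ### Limits of holomorphic maps of one variable and their identity theorem. -/

/-- An equicontinuous pointwise limit of holomorphic maps of one variable is holomorphic in
charts. -/
theorem exists_ball_differentiableOn_extChartAt_of_tendsto
    {E : Type*} [NormedAddCommGroup E] [NormedSpace ℂ E] [CompleteSpace E]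
    {X : Type*} [MetricSpace X] [CompactSpace X] [ChartedSpace E X] [IsManifold 𝓘(ℂ, E) 1 X]
    {ι : Type*} {l : Filter ι} [l.NeBot] {g : ι → ℂ → X} {G : ℂ → X} {S : Set ℂ}
    (hS : IsOpen S) (hg : ∀ n, MDifferentiableOn 𝓘(ℂ, ℂ) 𝓘(ℂ, E) (g n) S)
    (heq : ∀ z ∈ S, EquicontinuousAt g z)
    (hlim : ∀ z ∈ S, Filter.Tendsto (fun n => g n z) l (nhds (G z))) {z₀ : ℂ} (hz₀ : z₀ ∈ S) :
    ∃ δ > 0, Set.MapsTo G (Metric.ball z₀ δ) (extChartAt 𝓘(ℂ, E) (G z₀)).source ∧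
      DifferentiableOn ℂ (extChartAt 𝓘(ℂ, E) (G z₀) ∘ G) (Metric.ball z₀ δ) := by
  obtain ⟨r, hr, hrs⟩ := Metric.nhds_basis_closedBall.mem_iff.1
    (extChartAt_source_mem_nhds (I := 𝓘(ℂ, E)) (G z₀))
  set φ := extChartAt 𝓘(ℂ, E) (G z₀)
  have huc : UniformContinuousOn φ (Metric.closedBall (G z₀) r) :=
    (isCompact_closedBall _ _).uniformContinuousOn_of_continuous
      ((continuousOn_extChartAt _).mono hrs)
  obtain ⟨δ, hδ, hδS, hball⟩ :=
    (heq z₀ hz₀).exists_ball_dist_le_of_tendsto hS hz₀ hlim (half_pos hr)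
  -- Convergence at the centre alone costs `r / 2`, equicontinuity the other `r / 2`, so a single
  -- chart serves the whole ball.
  have hev : ∀ᶠ n in l, ∀ z ∈ Metric.ball z₀ δ, g n z ∈ Metric.closedBall (G z₀) r := by
    filter_upwards [(hlim z₀ hz₀).eventually (Metric.closedBall_mem_nhds _ (half_pos hr))]
      with n hn z hz
    have h1 := (hball z hz).1 n
    have h2 := dist_triangle (g n z) (g n z₀) (G z₀)
    simp only [Metric.mem_closedBall] at hn ⊢
    linarith
  have hG : ∀ z ∈ Metric.ball z₀ δ, G z ∈ Metric.closedBall (G z₀) r := fun z hz => by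
    have := (hball z hz).2
    simp only [Metric.mem_closedBall]
    linarith
  refine ⟨δ, hδ, fun z hz => hrs (hG z hz), ?_⟩
  have hunif : TendstoLocallyUniformlyOn (fun n => φ ∘ g n) (φ ∘ G) l (Metric.ball z₀ δ) := by
    rw [Metric.tendstoLocallyUniformlyOn_iff]
    intro ε hε z hz
    obtain ⟨η, hη, hηε⟩ := Metric.uniformContinuousOn_iff.1 huc ε hε
    have hη4 : 0 < η / 4 := by linarith
    obtain ⟨δ', hδ', -, hb'⟩ :=
      (heq z (hδS hz)).exists_ball_dist_le_of_tendsto hS (hδS hz) hlim hη4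
    refine ⟨Metric.ball z₀ δ ∩ Metric.ball z δ', Filter.inter_mem self_mem_nhdsWithin
      (mem_nhdsWithin_of_mem_nhds (Metric.ball_mem_nhds _ hδ')), ?_⟩
    filter_upwards [hev, (hlim z (hδS hz)).eventually (Metric.ball_mem_nhds _ hη4)]
      with n hn hnz w hw
    refine hηε _ (hG w hw.1) _ (hn w hw.1) ?_
    have h1 := (hb' w hw.2).1 n
    have h2 := (hb' w hw.2).2
    have h3 := dist_triangle4 (G w) (G z) (g n z) (g n w)
    rw [dist_comm (g n z) (g n w), dist_comm (G z) (g n z)] at h3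
    have h4 : dist (g n z) (G z) < η / 4 := hnz
    linarith
  -- Weierstrass: a locally uniform limit of holomorphic functions is holomorphic.
  refine hunif.differentiableOn ?_ Metric.isOpen_ball
  filter_upwards [hev] with n hn z hz
  have hd : MDifferentiableAt 𝓘(ℂ, ℂ) 𝓘(ℂ, E) (g n) z :=
    (hg n).mdifferentiableAt (hS.mem_nhds (hδS hz))
  have hsrc : g n z ∈ (chartAt E (G z₀)).source := by
    have := hrs (hn z hz)
    rwa [extChartAt_source] at this
  exact ((mdifferentiableAt_extChartAt hsrc).comp z hd).differentiableAt.differentiableWithinAt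

/-- The local identity theorem for limits of holomorphic maps of one variable. -/
theorem eventuallyEq_of_frequently_eq_of_differentiableOn_extChartAt
    {E : Type*} [NormedAddCommGroup E] [NormedSpace ℂ E] [CompleteSpace E]
    {X : Type*} [TopologicalSpace X] [ChartedSpace E X]
    {G H : ℂ → X} {z₀ : ℂ} (h₀ : G z₀ = H z₀)
    (hG : ∃ δ > 0, Set.MapsTo G (Metric.ball z₀ δ) (extChartAt 𝓘(ℂ, E) (G z₀)).source ∧
      DifferentiableOn ℂ (extChartAt 𝓘(ℂ, E) (G z₀) ∘ G) (Metric.ball z₀ δ))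
    (hH : ∃ δ > 0, Set.MapsTo H (Metric.ball z₀ δ) (extChartAt 𝓘(ℂ, E) (H z₀)).source ∧
      DifferentiableOn ℂ (extChartAt 𝓘(ℂ, E) (H z₀) ∘ H) (Metric.ball z₀ δ))
    (hfreq : ∃ᶠ z in nhdsWithin z₀ {z₀}ᶜ, G z = H z) : ∀ᶠ z in nhds z₀, G z = H z := by
  rw [← h₀] at hH
  obtain ⟨δ₁, hδ₁, hs₁, hd₁⟩ := hG
  obtain ⟨δ₂, hδ₂, hs₂, hd₂⟩ := hH
  have ha₁ := hd₁.analyticAt (Metric.ball_mem_nhds z₀ hδ₁)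
  have ha₂ := hd₂.analyticAt (Metric.ball_mem_nhds z₀ hδ₂)
  have := (ha₁.frequently_eq_iff_eventually_eq ha₂).1
    (hfreq.mono fun z hz => by simp only [Function.comp, hz])
  filter_upwards [this, Metric.ball_mem_nhds z₀ hδ₁, Metric.ball_mem_nhds z₀ hδ₂] with z h h1 h2
  exact (extChartAt 𝓘(ℂ, E) (G z₀)).injOn (hs₁ h1) (hs₂ h2) h

/-- The identity theorem for equicontinuous pointwise limits of holomorphic maps. -/
theorem eqOn_of_tendsto_of_frequently_eq
    {E : Type*} [NormedAddCommGroup E] [NormedSpace ℂ E] [CompleteSpace E]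
    {X : Type*} [MetricSpace X] [CompactSpace X] [ChartedSpace E X] [IsManifold 𝓘(ℂ, E) 1 X]
    {ι : Type*} {l : Filter ι} [l.NeBot] {g h : ι → ℂ → X} {G H : ℂ → X} {S : Set ℂ}
    (hS : IsOpen S) (hSc : IsPreconnected S)
    (hg : ∀ n, MDifferentiableOn 𝓘(ℂ, ℂ) 𝓘(ℂ, E) (g n) S)
    (hh : ∀ n, MDifferentiableOn 𝓘(ℂ, ℂ) 𝓘(ℂ, E) (h n) S)
    (hge : ∀ z ∈ S, EquicontinuousAt g z) (hhe : ∀ z ∈ S, EquicontinuousAt h z)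
    (hgl : ∀ z ∈ S, Filter.Tendsto (fun n => g n z) l (nhds (G z)))
    (hhl : ∀ z ∈ S, Filter.Tendsto (fun n => h n z) l (nhds (H z)))
    {z₀ : ℂ} (hz₀ : z₀ ∈ S) (hfreq : ∃ᶠ z in nhdsWithin z₀ {z₀}ᶜ, G z = H z) :
    Set.EqOn G H S := by
  have hcont : ∀ {f : ι → ℂ → X} {F : ℂ → X}, (∀ z ∈ S, EquicontinuousAt f z) →
      (∀ z ∈ S, Filter.Tendsto (fun n => f n z) l (nhds (F z))) →
      ∀ z ∈ S, ContinuousAt F z := by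
    intro f F he hl z hz
    rw [Metric.continuousAt_iff]
    intro ε hε
    obtain ⟨δ, hδ, -, hb⟩ := (he z hz).exists_ball_dist_le_of_tendsto hS hz hl (half_pos hε)
    exact ⟨δ, hδ, fun w hw => ((hb w hw).2).trans_lt (half_lt_self hε)⟩
  have hlocal : ∀ z ∈ S, (∃ᶠ w in nhdsWithin z {z}ᶜ, G w = H w) → ∀ᶠ w in nhds z, G w = H w := by
    intro z hz hf
    have h₀ : G z = H z := by
      by_contra hne
      refine hf (Filter.Eventually.filter_mono nhdsWithin_le_nhds ?_)
      exact ((hcont hge hgl z hz).ne_iff_eventually_ne (hcont hhe hhl z hz)).1 hne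
    exact eventuallyEq_of_frequently_eq_of_differentiableOn_extChartAt h₀
      (exists_ball_differentiableOn_extChartAt_of_tendsto hS hg hge hgl hz)
      (exists_ball_differentiableOn_extChartAt_of_tendsto hS hh hhe hhl hz) hf
  set A : Set ℂ := {z | ∀ᶠ w in nhds z, G w = H w}
  have hAo : IsOpen A := isOpen_setOfPred_eventually_nhds
  -- `A` is relatively closed in `S`: a point of `S` in `closure A` but outside `A` is a limit of
  -- other points where `G = H`, so `hlocal` applies.
  have hsub : S ⊆ A := by
    refine hSc.subset_of_closure_inter_subset hAo ⟨z₀, hz₀, hlocal z₀ hz₀ hfreq⟩ ?_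
    rintro z ⟨hzA, hzS⟩
    by_contra hz
    refine hz (hlocal z hzS ?_)
    rw [frequently_nhdsWithin_iff]
    refine (mem_closure_iff_frequently.1 hzA).mono fun w hw => ⟨hw.self_of_nhds, ?_⟩
    rintro rfl
    exact hz hw
  exact fun z hz => (hsub hz).self_of_nhds

/-! ### Complex lines in the tube. -/

/-- The affine complex line `ζ ↦ a + i b + ζ v` with real data. -/
def realLine {m : ℕ} (a b v : Fin m → ℝ) (ζ : ℂ) : Fin m → ℂ :=
  realVec a + Complex.I • realVec b + ζ • realVec v

theorem realLine_im {m : ℕ} (a b v : Fin m → ℝ) (ζ : ℂ) :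
    (fun j => (realLine a b v ζ j).im) = b + ζ.im • v := by
  ext j
  simp [realLine, realVec]

theorem differentiable_realLine {m : ℕ} (a b v : Fin m → ℝ) :
    Differentiable ℂ (realLine a b v) := by
  unfold realLine
  fun_prop

/-- The parameters for which the line lies in the tube over `Ω`. -/
def lineStrip {m : ℕ} (Ω : Set (Fin m → ℝ)) (b v : Fin m → ℝ) : Set ℂ :=
  {ζ | b + ζ.im • v ∈ Ω}

theorem realLine_mem_tube {m : ℕ} {Ω : Set (Fin m → ℝ)} (a : Fin m → ℝ) {b v : Fin m → ℝ} {ζ : ℂ}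
    (hζ : ζ ∈ lineStrip Ω b v) : realLine a b v ζ ∈ tube Ω := by
  change (fun j => (realLine a b v ζ j).im) ∈ Ω
  rwa [realLine_im]

theorem isOpen_tube {m : ℕ} {Ω : Set (Fin m → ℝ)} (hΩ : IsOpen Ω) : IsOpen (tube Ω) :=
  hΩ.preimage (by fun_prop)

theorem isOpen_lineStrip {m : ℕ} {Ω : Set (Fin m → ℝ)} (hΩ : IsOpen Ω) (b v : Fin m → ℝ) :
    IsOpen (lineStrip Ω b v) :=
  hΩ.preimage (by fun_prop)

theorem convex_lineStrip {m : ℕ} {Ω : Set (Fin m → ℝ)} (hΩ : Convex ℝ Ω) (b v : Fin m → ℝ) :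
    Convex ℝ (lineStrip Ω b v) := by
  intro z hz w hw s t hs ht hst
  have := hΩ hz hw hs ht hst
  change b + (s • z + t • w).im • v ∈ Ω
  convert this using 1
  ext j
  simp
  linear_combination (-b j) * hst

/-- The vectors `a n` only translate in real directions, so near `ζ` all the lines stay over one
compact base and a single modulus of continuity of `F` serves every `n`. -/
theorem equicontinuousAt_comp_realLine {m : ℕ} {X : Type*} [MetricSpace X]
    {Ω : Set (Fin m → ℝ)} (hΩ : IsOpen Ω) {F : (Fin m → ℂ) → X}
    (hunif : ∀ K : Set (Fin m → ℝ), IsCompact K → K ⊆ Ω → UniformContinuousOn F (tube K))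
    {ι : Type*} (a : ι → Fin m → ℝ) {b v : Fin m → ℝ} {ζ : ℂ} (hζ : ζ ∈ lineStrip Ω b v) :
    EquicontinuousAt (fun n => F ∘ realLine (a n) b v) ζ := by
  obtain ⟨r, hr, hrs⟩ := Metric.nhds_basis_closedBall.mem_iff.1
    ((isOpen_lineStrip hΩ b v).mem_nhds hζ)
  set K : Set (Fin m → ℝ) := (fun w : ℂ => b + w.im • v) '' Metric.closedBall ζ r
  have hK : IsCompact K := (isCompact_closedBall ζ r).image (by fun_prop)
  have hKΩ : K ⊆ Ω := by
    rintro _ ⟨w, hw, rfl⟩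
    exact hrs hw
  rw [Metric.equicontinuousAt_iff]
  intro ε hε
  obtain ⟨δ, hδ, h⟩ := Metric.uniformContinuousOn_iff.1 (hunif K hK hKΩ) ε hε
  have hc : ContinuousAt (realLine 0 b v) ζ := (differentiable_realLine 0 b v).continuous.continuousAt
  obtain ⟨δ', hδ', h'⟩ := Metric.continuousAt_iff.1 hc δ hδ
  refine ⟨min r δ', lt_min hr hδ', fun w hw n => ?_⟩
  have hmem : ∀ u ∈ Metric.closedBall ζ r, realLine (a n) b v u ∈ tube K := fun u hu =>
    realLine_mem_tube (a n) (show b + u.im • v ∈ K from ⟨u, hu, rfl⟩)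
  refine h _ (hmem ζ (Metric.mem_closedBall_self hr.le)) _
    (hmem w (hw.le.trans (min_le_left _ _))) ?_
  have h1 := h' (lt_of_lt_of_le hw (min_le_right _ _))
  rw [dist_comm, dist_eq_norm] at h1
  rw [dist_eq_norm]
  convert h1 using 2
  simp [realLine]

theorem realLine_of_im {m : ℕ} (a b y : Fin m → ℝ) :
    realLine a b (y - b) Complex.I = realVec a + Complex.I • realVec y := by
  ext j
  simp [realLine, realVec]
  ring

/-! ### Propagation of closeness from one base point to a compact set. -/

/-- If two families of real shifts of `F` approach each other uniformly over one point of the base,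
then they do so over every other point. -/
theorem tendsto_dist_shift {m : ℕ}
    {E : Type*} [NormedAddCommGroup E] [NormedSpace ℂ E] [CompleteSpace E]
    {X : Type*} [MetricSpace X] [CompactSpace X] [ChartedSpace E X] [IsManifold 𝓘(ℂ, E) 1 X]
    {Ω : Set (Fin m → ℝ)} (hΩo : IsOpen Ω) (hΩc : Convex ℝ Ω) {F : (Fin m → ℂ) → X}
    (hF : MDifferentiableOn 𝓘(ℂ, Fin m → ℂ) 𝓘(ℂ, E) F (tube Ω))
    (hunif : ∀ K : Set (Fin m → ℝ), IsCompact K → K ⊆ Ω → UniformContinuousOn F (tube K))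
    {y' y : Fin m → ℝ} (hy' : y' ∈ Ω) (hy : y ∈ Ω) {ι : Type*} (l : Ultrafilter ι)
    (a b : ι → Fin m → ℝ)
    (hab : ∀ x : Fin m → ℝ, Filter.Tendsto
      (fun n => dist (F (realVec x + realVec (a n) + Complex.I • realVec y'))
        (F (realVec x + realVec (b n) + Complex.I • realVec y'))) l (nhds 0)) :
    Filter.Tendsto (fun n => dist (F (realVec (a n) + Complex.I • realVec y))
      (F (realVec (b n) + Complex.I • realVec y))) l (nhds 0) := by
  set v := y - y'
  -- An ultrafilter converges at every `ζ` simultaneously, so no subsequences are extracted.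
  have hlim : ∀ (c : ι → Fin m → ℝ) (ζ : ℂ), ∃ p : X,
      Filter.Tendsto (fun n => (F ∘ realLine (c n) y' v) ζ) l (nhds p) := by
    intro c ζ
    obtain ⟨p, -, hp⟩ := isCompact_univ.ultrafilter_le_nhds
      (l.map fun n => (F ∘ realLine (c n) y' v) ζ) (by simp)
    exact ⟨p, hp⟩
  choose G hG using hlim a
  choose H hH using hlim b
  have hdiff : ∀ c : Fin m → ℝ, MDifferentiableOn 𝓘(ℂ, ℂ) 𝓘(ℂ, E) (F ∘ realLine c y' v)
      (lineStrip Ω y' v) := fun c =>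
    hF.comp (differentiable_realLine c y' v).mdifferentiable.mdifferentiableOn
      fun ζ hζ => realLine_mem_tube c hζ
  have hreal : ∀ s : ℝ, G s = H s := by
    intro s
    have h1 := (hG s).dist (hH s)
    have h2 := hab (s • v)
    have h3 : ∀ c : Fin m → ℝ,
        realVec (s • v) + realVec c + Complex.I • realVec y' = realLine c y' v s := by
      intro c
      ext j
      simp [realLine, realVec]
      ring
    simp only [h3] at h2
    exact dist_eq_zero.1 (tendsto_nhds_unique h1 h2)
  have h0 : (0 : ℂ) ∈ lineStrip Ω y' v := by simpa [lineStrip] using hy'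
  have hI : Complex.I ∈ lineStrip Ω y' v := by simpa [lineStrip, v] using hy
  have hfreq : ∃ᶠ z in nhdsWithin (0 : ℂ) {0}ᶜ, G z = H z := by
    have ht : Filter.Tendsto (fun s : ℝ => (s : ℂ)) (nhdsWithin 0 {0}ᶜ)
        (nhdsWithin (0 : ℂ) {0}ᶜ) := by
      refine tendsto_nhdsWithin_iff.2 ⟨?_, ?_⟩
      · have := (Complex.continuous_ofReal.tendsto 0).mono_left
          (nhdsWithin_le_nhds (s := ({0}ᶜ : Set ℝ)))
        simpa using this
      · filter_upwards [self_mem_nhdsWithin] with s hs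
        simpa using hs
    exact ht.frequently (Filter.Frequently.of_forall hreal)
  have key := eqOn_of_tendsto_of_frequently_eq (isOpen_lineStrip hΩo y' v)
    (convex_lineStrip hΩc y' v).isPreconnected (fun n => hdiff (a n)) (fun n => hdiff (b n))
    (fun z hz => equicontinuousAt_comp_realLine hΩo hunif a hz)
    (fun z hz => equicontinuousAt_comp_realLine hΩo hunif b hz)
    (fun z _ => hG z) (fun z _ => hH z) h0 hfreq hI
  have := (hG Complex.I).dist (hH Complex.I)
  simpa only [key, dist_self, Function.comp, v, realLine_of_im] using this

theorem realVec_add_I_smul_mem_tube {m : ℕ} {K : Set (Fin m → ℝ)} (x : Fin m → ℝ)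
    {y : Fin m → ℝ} (hy : y ∈ K) : realVec x + Complex.I • realVec y ∈ tube K := by
  simpa [tube, realVec] using hy

theorem realVec_add {m : ℕ} (s t : Fin m → ℝ) : realVec (s + t) = realVec s + realVec t := by
  ext j
  simp [realVec]

theorem realVec_re_add_I_smul_im {m : ℕ} (z : Fin m → ℂ) :
    realVec (fun j => (z j).re) + Complex.I • realVec (fun j => (z j).im) = z := by
  ext j
  simp [realVec, mul_comm Complex.I, Complex.re_add_im]

/-- Shifts of `F` that are close over one point of the base are close over a compact set. -/
theorem exists_dist_shift_lt {m : ℕ}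
    {E : Type*} [NormedAddCommGroup E] [NormedSpace ℂ E] [CompleteSpace E]
    {X : Type*} [MetricSpace X] [CompactSpace X] [ChartedSpace E X] [IsManifold 𝓘(ℂ, E) 1 X]
    {Ω : Set (Fin m → ℝ)} (hΩo : IsOpen Ω) (hΩc : Convex ℝ Ω) {F : (Fin m → ℂ) → X}
    (hF : MDifferentiableOn 𝓘(ℂ, Fin m → ℂ) 𝓘(ℂ, E) F (tube Ω))
    (hunif : ∀ K : Set (Fin m → ℝ), IsCompact K → K ⊆ Ω → UniformContinuousOn F (tube K))
    {y' : Fin m → ℝ} (hy' : y' ∈ Ω) {K : Set (Fin m → ℝ)} (hK : IsCompact K) (hKΩ : K ⊆ Ω)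
    {ε : ℝ} (hε : 0 < ε) :
    ∃ δ > 0, ∀ s t : Fin m → ℝ,
      (∀ z ∈ tube {y'}, dist (F (z + realVec s)) (F (z + realVec t)) < δ) →
      ∀ z ∈ tube K, dist (F (z + realVec s)) (F (z + realVec t)) < ε := by
  by_contra! hcon
  have hpos : ∀ n : ℕ, (0 : ℝ) < 1 / ((n : ℝ) + 1) := fun n => Nat.one_div_pos_of_nat
  choose s t hst z hzK hz using fun n : ℕ => hcon _ (hpos n)
  set x : ℕ → Fin m → ℝ := fun n j => (z n j).re
  set Y : ℕ → Fin m → ℝ := fun n j => (z n j).im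
  set l : Ultrafilter ℕ := Filter.hyperfilter ℕ
  have hl : (l : Filter ℕ) ≤ Filter.atTop := Nat.hyperfilter_le_atTop
  obtain ⟨y, hy, hYy⟩ := hK.ultrafilter_le_nhds (l.map Y)
    (Filter.le_principal_iff.2 (Filter.mem_map.2 (Filter.univ_mem' hzK)))
  have hYy : Filter.Tendsto Y l (nhds y) := hYy
  have hzn : ∀ n (c : Fin m → ℝ),
      z n + realVec c = realVec (x n + c) + Complex.I • realVec (Y n) := by
    intro n c
    rw [realVec_add]
    nth_rewrite 1 [← realVec_re_add_I_smul_im (z n)]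
    abel
  -- Adding `x n` to both translations is harmless, since closeness over `y'` holds at every real
  -- part.
  have hab := tendsto_dist_shift hΩo hΩc hF hunif hy' (hKΩ hy) l (fun n => x n + s n)
    (fun n => x n + t n) (by
      intro u
      refine squeeze_zero (fun _ => dist_nonneg) (fun n => ?_)
        (tendsto_one_div_add_atTop_nhds_zero_nat.mono_left hl)
      have := hst n _ (realVec_add_I_smul_mem_tube (u + x n) (Set.mem_singleton y'))
      refine le_trans (le_of_eq ?_) this.le
      congr 2 <;> simp only [realVec_add] <;> abel)
  obtain ⟨δ, hδ, hδε⟩ := Metric.uniformContinuousOn_iff.1 (hunif K hK hKΩ) (ε / 3) (by linarith)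
  have hIY : Filter.Tendsto (fun n => Complex.I • realVec (Y n)) l
      (nhds (Complex.I • realVec y)) := by
    have hc : Continuous fun w : Fin m → ℝ => Complex.I • realVec w := by
      unfold realVec
      fun_prop
    exact (hc.tendsto y).comp hYy
  -- Uniform continuity replaces `Y n` by its limit `y`, whatever the real parts `c n`.
  have hclose : ∀ c : ℕ → Fin m → ℝ, ∀ᶠ n in (l : Filter ℕ),
      dist (F (realVec (c n) + Complex.I • realVec (Y n)))
        (F (realVec (c n) + Complex.I • realVec y)) < ε / 3 := by
    intro c
    filter_upwards [hIY.eventually (Metric.ball_mem_nhds _ hδ)] with n hn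
    refine hδε _ (realVec_add_I_smul_mem_tube _ (hzK n)) _ (realVec_add_I_smul_mem_tube _ hy) ?_
    rwa [dist_add_left]
  have hev := (hclose fun n => x n + s n).and ((hclose fun n => x n + t n).and
    (hab.eventually (Metric.ball_mem_nhds (0 : ℝ) (show 0 < ε / 3 by linarith))))
  obtain ⟨n, h1, h2, h3⟩ := hev.exists
  have h4 := hz n
  rw [hzn, hzn] at h4
  rw [Real.dist_0_eq_abs, abs_of_nonneg dist_nonneg] at h3
  have h5 := dist_triangle4 (F (realVec (x n + s n) + Complex.I • realVec (Y n)))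
    (F (realVec (x n + s n) + Complex.I • realVec y))
    (F (realVec (x n + t n) + Complex.I • realVec y))
    (F (realVec (x n + t n) + Complex.I • realVec (Y n)))
  rw [dist_comm (F (realVec (x n + t n) + Complex.I • realVec y))] at h5
  linarith

theorem mainTheorem2 {m : ℕ}
    {E : Type*} [NormedAddCommGroup E] [NormedSpace ℂ E] [FiniteDimensional ℂ E]
    {X : Type*} [MetricSpace X] [CompactSpace X] [ChartedSpace E X] [IsManifold 𝓘(ℂ, E) ω X]
    (Ω : Set (Fin m → ℝ)) (hΩo : IsOpen Ω) (hΩc : Convex ℝ Ω)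
    (F : (Fin m → ℂ) → X)
    (hF : MDifferentiableOn 𝓘(ℂ, Fin m → ℂ) 𝓘(ℂ, E) F (tube Ω))
    (hunif : ∀ K : Set (Fin m → ℝ), IsCompact K → K ⊆ Ω → UniformContinuousOn F (tube K))
    (y' : Fin m → ℝ) (hy' : y' ∈ Ω) (hsp : SemiPeriodicOnTube F {y'}) :
    SemiPeriodicOnOpenTube F Ω := by
  have : CompleteSpace E := FiniteDimensional.complete ℂ E
  have : IsManifold 𝓘(ℂ, E) 1 X := IsManifold.of_le (n := ω) le_top
  intro K hK hKΩ
  refine ⟨(hunif K hK hKΩ).continuousOn, ?_⟩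
  have htb : TotallyBounded (Set.range (shiftOnTube F {y'})) :=
    hsp.2.totallyBounded.subset subset_closure
  suffices h : TotallyBounded (Set.range (shiftOnTube F K)) from
    isCompact_iff_totallyBounded_isComplete.2 ⟨h.closure, isClosed_closure.isComplete⟩
  rw [(UniformFun.hasBasis_uniformity_of_basis (tube K) X
    Metric.uniformity_basis_dist).totallyBounded_iff]
  intro ε hε
  obtain ⟨δ, hδ, h⟩ := exists_dist_shift_lt hΩo hΩc hF hunif hy' hK hKΩ hε
  have hmem := (UniformFun.hasBasis_uniformity_of_basis (tube {y'}) X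
    Metric.uniformity_basis_dist).mem_of_mem hδ
  -- The net is taken inside the range, so its members are shifts and their translations can be
  -- reused over `K`.
  obtain ⟨N, hNs, hNf, hN⟩ := totallyBounded_iff_subset.1 htb _ hmem
  have hex : ∀ f : tube {y'} →ᵤ X, ∃ t : Fin m → ℝ, f ∈ N → shiftOnTube F {y'} t = f := by
    intro f
    by_cases hf : f ∈ N
    · obtain ⟨t, ht⟩ := hNs hf
      exact ⟨t, fun _ => ht⟩
    · exact ⟨0, fun h => absurd h hf⟩
  choose c hc using hex
  refine ⟨(fun f => shiftOnTube F K (c f)) '' N, hNf.image _, ?_⟩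
  rintro _ ⟨t, rfl⟩
  obtain ⟨f, hf, htf⟩ := Set.mem_iUnion₂.1 (hN ⟨t, rfl⟩)
  rw [Set.biUnion_image]
  refine Set.mem_iUnion₂.2 ⟨f, hf, fun z => h t (c f) (fun w hw => ?_) z z.2⟩
  rw [← hc f hf] at htf
  exact htf ⟨w, hw⟩
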